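/- Let $W$ be the affine Weyl group of type $\tilde A_2$, i.e. the Coxeter group generated by three simple reflections $s_0,s_1,s_2$ subject to the relations $s_i^2=1$ and $(s_is_j)^3=1$ for $i\neq j$. Let $\ell$ be the length function with respect to $s_0,s_1,s_2$, call the conjugates in $W$ of the $s_i$ the reflections, and let $\leq$ be the Bruhat order on $W$, that is, the partial order generated by the relations $u<ru$ where $r$ is a reflection and $\ell(u)<\ell(ru)$. An element of $W$ is called spiral if it has a reduced expression of the form $s_is_js_ks_is_js_ks_i\cdots$ (of any finite length $\ge 0$) with $i,j,k$ distinct. For $x,w\in W$ with $x\leq w$ put $$q^w_x=\#\{\,r\in W : r \text{ is a reflection and } rx\leq w\,\}-\ell(w).$$ Let $w\in W$ be non-spiral, and let $x,y\in W$ with $y\leq x\leq w$. If $q^w_x>0$, then $q^w_y>0$. -/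

import Mathlib

namespace AffineA2

/-- The Coxeter matrix of type `Ã₂`: three simple reflections `s₀, s₁, s₂`, any two distinct ones
having a product of order `3`. -/
def matrix : CoxeterMatrix (Fin 3) where
  M := !![1, 3, 3;
          3, 1, 3;
          3, 3, 1]
  isSymm := by decide
  diagonal := by decide
  off_diagonal i j h := by fin_cases i <;> fin_cases j <;> simp_all

end AffineA2

namespace CoxeterSystem

variable {B : Type*} {W : Type*} [Group W] {M : CoxeterMatrix B} (cs : CoxeterSystem M W)

/-- The Bruhat order: `cs.BruhatLE x w` means `x ≤ w`. It is the partial order generated by the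
relations `u < r u`, where `r` is a reflection and `ℓ(u) < ℓ(r u)`. -/
def BruhatLE : W → W → Prop :=
  Relation.ReflTransGen fun u v =>
    ∃ r : W, cs.IsReflection r ∧ v = r * u ∧ cs.length u < cs.length (r * u)

theorem BruhatLE.length_le {cs : CoxeterSystem M W} {x w : W} (h : cs.BruhatLE x w) :
    cs.length x ≤ cs.length w := by
  induction h with
  | refl => exact le_rfl
  | tail _ h ih =>
    obtain ⟨r, _, rfl, hlt⟩ := h
    exact ih.trans hlt.le

/-- The set of reflections `r` with `r x ≤ w`. -/
def reflectionsBelow (w x : W) : Set W :=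
  {r | cs.IsReflection r ∧ cs.BruhatLE (r * x) w}

/-- If there are finitely many simple reflections then `reflectionsBelow` is finite, so that its
`Set.ncard` is the true number of elements. -/
theorem finite_reflectionsBelow [Finite B] (w x : W) : (cs.reflectionsBelow w x).Finite := by
  have h1 : (cs.wordProd '' {l : List B | l.length ≤ cs.length w}).Finite :=
    (List.finite_length_le B (cs.length w)).image _
  refine Set.Finite.of_finite_image (f := fun r => r * x) (h1.subset ?_)
    (mul_left_injective x).injOn
  rintro _ ⟨r, hr, rfl⟩
  obtain ⟨l, hl, hw⟩ := cs.exists_isReduced (r * x)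
  refine ⟨l, ?_, hw.symm⟩
  have h2 := hr.2.length_le
  rwa [hw, hl] at h2

/-- `q^w_x`: the number of reflections `r` with `r x ≤ w`, minus `ℓ(w)` (an integer). -/
noncomputable def q (w x : W) : ℤ :=
  ((cs.reflectionsBelow w x).ncard : ℤ) - (cs.length w : ℤ)

end CoxeterSystem

namespace AffineA2

/-- The word `i j k i j k i …` of length `n`. -/
def spiralWord (i j k : Fin 3) : ℕ → List (Fin 3)
  | 0 => []
  | n + 1 => i :: spiralWord j k i n

/-- An element is spiral if it has a reduced expression `sᵢ sⱼ sₖ sᵢ sⱼ sₖ sᵢ …` (of any length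
`n ≥ 0`) with `i, j, k` distinct. -/
def IsSpiral {W : Type*} [Group W] (cs : CoxeterSystem matrix W) (w : W) : Prop :=
  ∃ (i j k : Fin 3) (n : ℕ), i ≠ j ∧ j ≠ k ∧ i ≠ k ∧
    cs.IsReduced (spiralWord i j k n) ∧ cs.wordProd (spiralWord i j k n) = w

end AffineA2

/-! The affine Weyl group acts simply transitively on the alcoves of the `Ã₂` arrangement, so
`q^w_x` counts the reflections that take the alcove of `x` into the lower interval of the alcove of
`w`, up to the constant `ℓ(w)`. The spiral elements are those whose alcove shares with the
fundamental one a strip between two adjacent parallel lines. For every other `w` the lower interval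
is a hexagon whose sides are perpendicular to the lines of the arrangement. The reflections in the
lines of one parallel class move an alcove along a chord of this hexagon, and the number of those
that keep it inside is about a third of the length of the chord.

A reflection preserves the chord in its own direction and exchanges the other two. If it increases
the length, it moves these away from the centre, so they get shorter. Hence the number of
reflections would be antitone in `x`, if it were not for one reflection missing on some chords
through the centre; there a parity argument shows that the positivity of `q^w_x` is not affected. -/

namespace AffineA2

/-- The indices `i`, `j`, `k` are the three elements of `Fin 3`, in some order. -/
structure Distinct (i j k : Fin 3) : Prop where
  fst_ne_snd : i ≠ j
  snd_ne_trd : j ≠ k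
  fst_ne_trd : i ≠ k

namespace Distinct

variable {i j k : Fin 3}

theorem swap (h : Distinct i j k) : Distinct j i k :=
  ⟨h.fst_ne_snd.symm, h.fst_ne_trd, h.snd_ne_trd⟩

theorem rotate (h : Distinct i j k) : Distinct k i j :=
  ⟨h.fst_ne_trd.symm, h.fst_ne_snd, h.snd_ne_trd.symm⟩

theorem eq_or_eq_or_eq (h : Distinct i j k) (l : Fin 3) : l = i ∨ l = j ∨ l = k := by
  obtain ⟨hij, hjk, hik⟩ := h
  omega

theorem sum_eq {M : Type*} [AddCommMonoid M] (h : Distinct i j k) (f : Fin 3 → M) :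
    ∑ l, f l = f i + f j + f k := by
  have huniv : Finset.univ = {i, j, k} := by
    ext l
    simpa using h.eq_or_eq_or_eq l
  rw [huniv, Finset.sum_insert (by simp [h.fst_ne_snd, h.fst_ne_trd]),
    Finset.sum_pair h.snd_ne_trd, add_assoc]

end Distinct

theorem exists_distinct_of_ne {i j : Fin 3} (hij : i ≠ j) : ∃ k, Distinct i j k := by
  obtain ⟨k, hjk, hik⟩ : ∃ k, j ≠ k ∧ i ≠ k :=
    (by decide : ∀ i j : Fin 3, ∃ k, j ≠ k ∧ i ≠ k) i j
  exact ⟨k, hij, hjk, hik⟩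

theorem exists_distinct (i : Fin 3) : ∃ j k, Distinct i j k :=
  ⟨i + 1, exists_distinct_of_ne (by simp)⟩

/-- An alcove of the affine `A₂` arrangement. The plane is `{α₀ + α₁ + α₂ = 1}`, the hyperplanes are
the lines on which some `αᵢ` is an integer, and an alcove is encoded by the integer parts of
`α₀, α₁, α₂` on it; these add up to `0` or `-1`, depending on the orientation of the alcove. -/
@[ext]
structure Alcove where
  coord : Fin 3 → ℤ
  sum_coord : ∑ i, coord i = 0 ∨ ∑ i, coord i = -1

namespace Alcove

instance : CoeFun Alcove fun _ => Fin 3 → ℤ := ⟨coord⟩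

variable {i j k : Fin 3}

theorem sum_eq_zero_or (h : Distinct i j k) (x : Alcove) :
    x i + x j + x k = 0 ∨ x i + x j + x k = -1 := by
  rw [← h.sum_eq]
  exact x.sum_coord

theorem ext_of_distinct (h : Distinct i j k) {x y : Alcove} (hi : x i = y i) (hj : x j = y j)
    (hk : x k = y k) : x = y := by
  ext l
  obtain rfl | rfl | rfl := h.eq_or_eq_or_eq l <;> assumption

/-- The fundamental alcove, on which `α₀, α₁, α₂ > 0`. -/
def base : Alcove := ⟨0, by simp⟩

@[simp]
theorem base_apply (i : Fin 3) : base i = 0 := rfl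

/-- The number of hyperplanes separating an alcove from the fundamental one. -/
def norm (x : Alcove) : ℕ := ∑ i, (x i).natAbs

@[simp]
theorem norm_base : base.norm = 0 := rfl

theorem norm_eq (h : Distinct i j k) (x : Alcove) :
    x.norm = (x i).natAbs + (x j).natAbs + (x k).natAbs :=
  h.sum_eq _

/-! ### Reflections of alcoves -/

/-- The reflection in the line `αᵢ = m`. It replaces `αᵢ` by `2m - αᵢ` and adds `αᵢ - m` to the
other two coordinates. For `j ≠ i` and the remaining index `k`, this takes the integer part of `αⱼ`
to `-xₖ - m`, and `xᵢ + xⱼ - ∑ xₗ` below stands for `-xₖ`. -/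
def reflect (i : Fin 3) (m : ℤ) (x : Alcove) : Alcove where
  coord j := if j = i then 2 * m - 1 - x i else x i + x j - ∑ l, x l - m
  sum_coord := by
    obtain ⟨j, k, h⟩ := exists_distinct i
    have := x.sum_eq_zero_or h
    rw [h.sum_eq, h.sum_eq, if_pos rfl, if_neg h.fst_ne_snd.symm, if_neg h.fst_ne_trd.symm]
    omega

@[simp]
theorem reflect_apply_self (i : Fin 3) (m : ℤ) (x : Alcove) : reflect i m x i = 2 * m - 1 - x i :=
  if_pos rfl

theorem reflect_apply_snd (h : Distinct i j k) (m : ℤ) (x : Alcove) :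
    reflect i m x j = -x k - m := by
  have hj : reflect i m x j = x i + x j - ∑ l, x l - m := if_neg h.fst_ne_snd.symm
  rw [hj, h.sum_eq]
  ring

theorem reflect_apply_trd (h : Distinct i j k) (m : ℤ) (x : Alcove) :
    reflect i m x k = -x j - m :=
  reflect_apply_snd h.rotate.swap m x

theorem reflect_reflect (i : Fin 3) (m : ℤ) (x : Alcove) : reflect i m (reflect i m x) = x := by
  obtain ⟨j, k, h⟩ := exists_distinct i
  apply ext_of_distinct h <;> simp [reflect_apply_snd h, reflect_apply_trd h]

theorem reflect_braid (h : Distinct i j k) (x : Alcove) :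
    reflect i 0 (reflect j 0 (reflect i 0 x)) = reflect j 0 (reflect i 0 (reflect j 0 x)) := by
  apply ext_of_distinct h <;>
    simp [reflect_apply_snd h, reflect_apply_trd h, reflect_apply_snd h.swap,
      reflect_apply_trd h.swap] <;> ring

/-- `reflect` as a permutation of the alcoves. -/
def reflectPerm (i : Fin 3) (m : ℤ) : Equiv.Perm Alcove :=
  Function.Involutive.toPerm (reflect i m) (reflect_reflect i m)

@[simp]
theorem reflectPerm_apply (i : Fin 3) (m : ℤ) (x : Alcove) :
    reflectPerm i m x = reflect i m x := rfl

theorem reflectPerm_inv (i : Fin 3) (m : ℤ) : (reflectPerm i m)⁻¹ = reflectPerm i m := rfl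

theorem conj_reflectPerm_self (i : Fin 3) (m : ℤ) :
    reflectPerm i 0 * reflectPerm i m * (reflectPerm i 0)⁻¹ = reflectPerm i (-m) := by
  obtain ⟨j, k, h⟩ := exists_distinct i
  rw [reflectPerm_inv]
  ext1 x
  apply ext_of_distinct h <;> simp [reflect_apply_snd h, reflect_apply_trd h] <;> ring

theorem conj_reflectPerm (h : Distinct i j k) (m : ℤ) :
    reflectPerm j 0 * reflectPerm i m * (reflectPerm j 0)⁻¹ = reflectPerm k (1 - m) := by
  rw [reflectPerm_inv]
  ext1 x
  apply ext_of_distinct h <;>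
    simp [reflect_apply_snd h, reflect_apply_trd h, reflect_apply_snd h.swap,
      reflect_apply_trd h.swap, reflect_apply_snd h.rotate, reflect_apply_trd h.rotate] <;> ring

/-- The right-hand side says that the line `αᵢ = m` does not separate `x` from the fundamental
alcove. -/
theorem norm_lt_norm_reflect_iff (i : Fin 3) (m : ℤ) (x : Alcove) :
    x.norm < (reflect i m x).norm ↔ m ≤ 0 ∧ m ≤ x i ∨ 0 < m ∧ x i < m := by
  obtain ⟨j, k, h⟩ := exists_distinct i
  have hx := x.sum_eq_zero_or h
  rw [norm_eq h, norm_eq h, reflect_apply_self, reflect_apply_snd h, reflect_apply_trd h]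
  omega

theorem norm_reflect_zero_of_neg {x : Alcove} (hi : x i < 0) :
    (reflect i 0 x).norm + 1 = x.norm := by
  obtain ⟨j, k, h⟩ := exists_distinct i
  rw [norm_eq h, norm_eq h, reflect_apply_self, reflect_apply_snd h, reflect_apply_trd h]
  omega

theorem norm_reflect_zero_le (i : Fin 3) (x : Alcove) : (reflect i 0 x).norm ≤ x.norm + 1 := by
  obtain ⟨j, k, h⟩ := exists_distinct i
  rw [norm_eq h, norm_eq h, reflect_apply_self, reflect_apply_snd h, reflect_apply_trd h]
  omega

theorem exists_apply_neg {x : Alcove} (hx : x ≠ base) : ∃ i, x i < 0 := by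
  by_contra! hc
  obtain ⟨j, k, h⟩ := exists_distinct 0
  have := x.sum_eq_zero_or h
  have := hc 0
  have := hc j
  have := hc k
  exact hx (ext_of_distinct h (by simp; omega) (by simp; omega) (by simp; omega))

theorem reflect_base_injective :
    Function.Injective fun t : (_ : Fin 3) × ℤ => reflect t.1 t.2 base := by
  rintro ⟨i, m⟩ ⟨j, n⟩ heq
  have happly (l : Fin 3) : reflect i m base l = reflect j n base l := congrArg (fun x => x l) heq
  by_cases hij : i = j
  · subst hij
    simpa using happly i
  · obtain ⟨k, h⟩ := exists_distinct_of_ne hij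
    have hi := happly i
    have hj := happly j
    have hk := happly k
    simp only [reflect_apply_self, reflect_apply_snd h, reflect_apply_trd h,
      reflect_apply_snd h.swap, reflect_apply_trd h.swap, base_apply] at hi hj hk
    omega

/-- The Bruhat order on alcoves. -/
instance : LE Alcove :=
  ⟨Relation.ReflTransGen fun x y => ∃ i m, y = reflect i m x ∧ x.norm < (reflect i m x).norm⟩

theorem le_of_reflect_le {m : ℤ} {w x : Alcove} (hlt : x.norm < (reflect i m x).norm)
    (hle : reflect i m x ≤ w) : x ≤ w :=
  .head ⟨i, m, rfl, hlt⟩ hle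

@[elab_as_elim]
theorem le_induction {w : Alcove} {P : ∀ x : Alcove, x ≤ w → Prop} (refl : P w .refl)
    (step : ∀ (x : Alcove) (i : Fin 3) (m : ℤ) (hlt : x.norm < (reflect i m x).norm)
      (hle : reflect i m x ≤ w), P (reflect i m x) hle → P x (le_of_reflect_le hlt hle))
    {x : Alcove} (hx : x ≤ w) : P x hx := by
  induction hx using Relation.ReflTransGen.head_induction_on with
  | refl => exact refl
  | head hstep hle ih =>
    obtain ⟨i, m, rfl, hlt⟩ := hstep
    exact step _ i m hlt hle ih

/-- The number of reflections taking `x` below `w`. -/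
noncomputable def numReflections (w x : Alcove) : ℕ :=
  {t : (_ : Fin 3) × ℤ | reflect t.1 t.2 x ≤ w}.ncard

theorem numReflections_eq_add_card (h : Distinct i j k) {w x : Alcove} {s t u : Finset ℤ}
    (hs : ∀ m, reflect i m x ≤ w ↔ m ∈ s) (ht : ∀ m, reflect j m x ≤ w ↔ m ∈ t)
    (hu : ∀ m, reflect k m x ≤ w ↔ m ∈ u) :
    numReflections w x = s.card + t.card + u.card := by
  have hfibre (l : Fin 3) : ∃ v : Finset ℤ, ∀ m, reflect l m x ≤ w ↔ m ∈ v := by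
    obtain rfl | rfl | rfl := h.eq_or_eq_or_eq l
    exacts [⟨s, hs⟩, ⟨t, ht⟩, ⟨u, hu⟩]
  choose f hf using hfibre
  have hsigma : {t : (_ : Fin 3) × ℤ | reflect t.1 t.2 x ≤ w} = Finset.univ.sigma f := by
    ext t
    simp [hf]
  obtain rfl : f i = s := Finset.ext fun m => (hf i m).symm.trans (hs m)
  obtain rfl : f j = t := Finset.ext fun m => (hf j m).symm.trans (ht m)
  obtain rfl : f k = u := Finset.ext fun m => (hf k m).symm.trans (hu m)
  rw [numReflections, hsigma, Set.ncard_coe_finset, Finset.card_sigma, h.sum_eq]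

end Alcove

/-! ### The group acts simply transitively on the alcoves -/

open Alcove

section

variable {i j k : Fin 3} {W : Type*} [Group W] (cs : CoxeterSystem matrix W)

theorem matrix_apply_of_ne (hij : i ≠ j) : matrix.M i j = 3 := by
  fin_cases i <;> fin_cases j <;> first | rfl | exact absurd rfl hij

theorem isLiftable_reflectPerm : matrix.IsLiftable fun i => reflectPerm i 0 := by
  intro i j
  by_cases hij : i = j
  · rw [hij, matrix.diagonal, pow_one]
    exact Equiv.ext (reflect_reflect j 0)
  · obtain ⟨k, h⟩ := exists_distinct_of_ne hij
    rw [matrix_apply_of_ne hij]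
    ext1 x
    simp only [pow_succ, pow_zero, one_mul, Equiv.Perm.mul_apply, reflectPerm_apply,
      Equiv.Perm.one_apply]
    rw [reflect_braid h, reflect_reflect, reflect_reflect, reflect_reflect]

/-- The action of the affine Weyl group on alcoves. -/
noncomputable def action : W →* Equiv.Perm Alcove :=
  cs.lift ⟨fun i => reflectPerm i 0, isLiftable_reflectPerm⟩

theorem action_simple (i : Fin 3) : action cs (cs.simple i) = reflectPerm i 0 :=
  cs.lift_apply_simple isLiftable_reflectPerm i

/-- The image of the fundamental alcove under a group element. -/
noncomputable def alcove (w : W) : Alcove := action cs w base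

theorem alcove_one : alcove cs 1 = base := by simp [alcove]

theorem alcove_mul (u v : W) : alcove cs (u * v) = action cs u (alcove cs v) := by
  simp [alcove]

theorem alcove_simple_mul (i : Fin 3) (w : W) :
    alcove cs (cs.simple i * w) = reflect i 0 (alcove cs w) := by
  simp [alcove_mul, action_simple]

theorem simple_braid (hij : i ≠ j) :
    cs.simple i * cs.simple j * cs.simple i = cs.simple j * cs.simple i * cs.simple j := by
  have h := cs.simple_mul_simple_pow i j
  rw [matrix_apply_of_ne hij] at h
  calc cs.simple i * cs.simple j * cs.simple i
      = (cs.simple j * cs.simple i * cs.simple j)⁻¹ :=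
        eq_inv_of_mul_eq_one_left (by rw [← h]; simp only [pow_succ, pow_zero, one_mul, mul_assoc])
    _ = cs.simple j * cs.simple i * cs.simple j := by
        simp only [mul_inv_rev, cs.inv_simple, mul_assoc]

/-- `Reaches cs x w` says that `w` is the product of the simple reflections along some minimal
gallery from the fundamental alcove to `x`. The step condition `x i < 0` says that reflecting in
the wall `αᵢ = 0` shortens the gallery. -/
inductive Reaches : Alcove → W → Prop
  | base : Reaches Alcove.base 1
  | step {x : Alcove} {w : W} (i : Fin 3) : x i < 0 → Reaches (reflect i 0 x) w →
      Reaches x (cs.simple i * w)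

theorem exists_reaches (x : Alcove) : ∃ w, Reaches cs x w := by
  by_cases hx : x = base
  · exact ⟨1, hx ▸ .base⟩
  · obtain ⟨i, hi⟩ := exists_apply_neg hx
    obtain ⟨w, hw⟩ := exists_reaches (reflect i 0 x)
    exact ⟨_, .step i hi hw⟩
termination_by x.norm
decreasing_by exact (norm_reflect_zero_of_neg hi).le

variable {cs}

theorem exists_reaches_of_neg_of_neg {x : Alcove} (h : Distinct i j k) (hi : x i < 0)
    (hj : x j < 0) :
    ∃ t, Reaches cs (reflect i 0 x) (cs.simple j * (cs.simple i * t)) ∧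
      Reaches cs (reflect j 0 x) (cs.simple i * (cs.simple j * t)) := by
  obtain ⟨t, ht⟩ := exists_reaches cs (reflect i 0 (reflect j 0 (reflect i 0 x)))
  have hsum := x.sum_eq_zero_or h
  refine ⟨t, .step j ?_ (.step i ?_ ht), .step i ?_ (.step j ?_ (reflect_braid h x ▸ ht))⟩ <;>
    simp only [reflect_apply_snd h, reflect_apply_trd h, reflect_apply_snd h.swap,
      reflect_apply_trd h.swap] <;>
    omega

theorem Reaches.unique {x : Alcove} {w w' : W} (h : Reaches cs x w) (h' : Reaches cs x w') :
    w = w' := by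
  induction hn : x.norm using Nat.strong_induction_on generalizing x w w' with
  | _ n ih =>
    subst hn
    cases h with
    | base =>
      generalize hx : Alcove.base = x at h'
      cases h' with
      | base => rfl
      | step i hi _ => simp [← hx] at hi
    | @step _ u i hi hu =>
      cases h' with
      | base => simp at hi
      | @step _ v j hj hv =>
        have hlti := (norm_reflect_zero_of_neg hi).le
        have hltj := (norm_reflect_zero_of_neg hj).le
        by_cases hij : i = j
        · subst hij
          rw [ih _ hlti hu hv rfl]
        · obtain ⟨k, h⟩ := exists_distinct_of_ne hij
          obtain ⟨t, hi', hj'⟩ := exists_reaches_of_neg_of_neg (cs := cs) h hi hj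
          rw [ih _ hlti hu hi' rfl, ih _ hltj hv hj' rfl]
          simp only [← mul_assoc, simple_braid cs hij]

theorem Reaches.simple_mul {x : Alcove} {w : W} (h : Reaches cs x w) (i : Fin 3) :
    Reaches cs (reflect i 0 x) (cs.simple i * w) := by
  rcases lt_or_ge (x i) 0 with hi | hi
  · obtain ⟨v, hv⟩ := exists_reaches cs (reflect i 0 x)
    rwa [h.unique (.step i hi hv), cs.simple_mul_simple_cancel_left]
  · exact .step i (by rw [reflect_apply_self]; omega) (by rwa [reflect_reflect])

theorem Reaches.length_le {x : Alcove} {w : W} (h : Reaches cs x w) : cs.length w ≤ x.norm := by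
  induction h with
  | base => simp
  | @step x w i hi _ ih =>
    calc cs.length (cs.simple i * w) ≤ cs.length (cs.simple i) + cs.length w := cs.length_mul_le _ _
      _ ≤ (reflect i 0 x).norm + 1 := by rw [cs.length_simple]; omega
      _ = x.norm := norm_reflect_zero_of_neg hi

variable (cs)

theorem reaches_alcove (w : W) : Reaches cs (alcove cs w) w := by
  induction w using cs.simple_induction_left with
  | one => rw [alcove_one]; exact .base
  | mul_simple_left w i ih => rw [alcove_simple_mul]; exact ih.simple_mul i

theorem alcove_injective : Function.Injective (alcove cs) := fun u v huv =>
  (reaches_alcove cs u).unique (huv ▸ reaches_alcove cs v)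

theorem norm_alcove_wordProd_le (l : List (Fin 3)) :
    (alcove cs (cs.wordProd l)).norm ≤ l.length := by
  induction l with
  | nil => simp [alcove_one]
  | cons i l ih =>
    rw [cs.wordProd_cons, alcove_simple_mul, List.length_cons]
    exact (norm_reflect_zero_le i _).trans (Nat.succ_le_succ ih)

theorem length_eq_norm (w : W) : cs.length w = (alcove cs w).norm := by
  refine le_antisymm (reaches_alcove cs w).length_le ?_
  obtain ⟨l, hl, rfl⟩ := cs.exists_isReduced w
  rw [hl.eq]
  exact norm_alcove_wordProd_le cs l

/-! ### Bruhat order and reflections in terms of alcoves -/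

variable {cs} in
theorem exists_action_eq_reflectPerm {r : W} (hr : cs.IsReflection r) :
    ∃ i m, action cs r = reflectPerm i m := by
  obtain ⟨w, i, rfl⟩ := hr
  induction w using cs.simple_induction_left with
  | one => exact ⟨i, 0, by simp [action_simple]⟩
  | mul_simple_left w j ih =>
    obtain ⟨k, m, hk⟩ := ih
    have hconj : cs.simple j * w * cs.simple i * (cs.simple j * w)⁻¹ =
      cs.simple j * (w * cs.simple i * w⁻¹) * (cs.simple j)⁻¹ := by group
    rw [hconj, map_mul, map_mul, map_inv, hk, action_simple]
    by_cases hkj : k = j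
    · subst hkj
      exact ⟨_, _, conj_reflectPerm_self k m⟩
    · obtain ⟨l, h⟩ := exists_distinct_of_ne hkj
      exact ⟨_, _, conj_reflectPerm h m⟩

theorem exists_isReflection (i : Fin 3) (m : ℤ) :
    ∃ r, cs.IsReflection r ∧ action cs r = reflectPerm i m := by
  have conj {i j k : Fin 3} {m n : ℤ}
      (h : reflectPerm j 0 * reflectPerm i m * (reflectPerm j 0)⁻¹ = reflectPerm k n) :
      (∃ r, cs.IsReflection r ∧ action cs r = reflectPerm i m) →
      ∃ r, cs.IsReflection r ∧ action cs r = reflectPerm k n := by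
    rintro ⟨r, hr, hi⟩
    refine ⟨_, hr.conj (cs.simple j), ?_⟩
    rw [map_mul, map_mul, map_inv, hi, action_simple, h]
  have nat (n : ℕ) : ∀ i, ∃ r, cs.IsReflection r ∧ action cs r = reflectPerm i n := by
    induction n with
    | zero => exact fun i => ⟨_, cs.isReflection_simple i, action_simple cs i⟩
    | succ n ih =>
      intro i
      obtain ⟨j, k, h⟩ := exists_distinct i
      have hsucc : ((n + 1 : ℕ) : ℤ) = 1 - -n := by push_cast; ring
      rw [hsucc]
      exact conj (conj_reflectPerm h.swap.rotate (-n)) (conj (conj_reflectPerm_self k n) (ih k))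
  obtain ⟨n, rfl | rfl⟩ := m.eq_nat_or_neg
  · exact nat n i
  · exact conj (conj_reflectPerm_self i n) (nat n i)

variable {cs}

theorem bruhatLE_iff {x w : W} : cs.BruhatLE x w ↔ alcove cs x ≤ alcove cs w := by
  constructor
  · refine Relation.ReflTransGen.lift (alcove cs) ?_ _ _
    rintro u v ⟨r, hr, rfl, hlt⟩
    obtain ⟨i, m, hi⟩ := exists_action_eq_reflectPerm hr
    have hru : alcove cs (r * u) = reflect i m (alcove cs u) := by
      rw [alcove_mul, hi, reflectPerm_apply]
    rw [length_eq_norm, length_eq_norm, hru] at hlt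
    exact ⟨i, m, hru, hlt⟩
  · intro h
    generalize hy : alcove cs x = y at h
    induction h using Alcove.le_induction generalizing x with
    | refl => exact alcove_injective cs hy ▸ .refl
    | step y i m hlt _ ih =>
      subst hy
      obtain ⟨r, hr, hi⟩ := exists_isReflection cs i m
      have hrx : alcove cs (r * x) = reflect i m (alcove cs x) := by
        rw [alcove_mul, hi, reflectPerm_apply]
      refine .head ⟨r, hr, rfl, ?_⟩ (ih hrx)
      rwa [length_eq_norm, length_eq_norm, hrx]

theorem q_eq (w x : W) :
    cs.q w x = numReflections (alcove cs w) (alcove cs x) - (alcove cs w).norm := by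
  rw [CoxeterSystem.q, length_eq_norm]
  choose f hf using exists_isReflection cs
  have hinj : Function.Injective fun t : (_ : Fin 3) × ℤ => f t.1 t.2 := by
    refine .of_comp (f := alcove cs) ?_
    simpa [Function.comp_def, alcove, hf] using reflect_base_injective
  have himage : cs.reflectionsBelow w x = (fun t : (_ : Fin 3) × ℤ => f t.1 t.2) ''
      {t | reflect t.1 t.2 (alcove cs x) ≤ alcove cs w} := by
    ext r
    constructor
    · rintro ⟨hr, hle⟩
      obtain ⟨i, m, hi⟩ := exists_action_eq_reflectPerm hr
      refine ⟨⟨i, m⟩, ?_, alcove_injective cs ?_⟩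
      · rwa [bruhatLE_iff, alcove_mul, hi] at hle
      · simp [alcove, hf, hi]
    · rintro ⟨⟨i, m⟩, hle, rfl⟩
      refine ⟨(hf i m).1, ?_⟩
      rwa [bruhatLE_iff, alcove_mul, (hf i m).2]
  rw [himage, Set.ncard_image_of_injective _ hinj, numReflections]

/-! ### Spiral elements -/

theorem length_spiralWord (i j k : Fin 3) (n : ℕ) : (spiralWord i j k n).length = n := by
  induction n generalizing i j k with
  | zero => rfl
  | succ n ih => rw [spiralWord, List.length_cons, ih]

theorem alcove_spiralWord (h : Distinct i j k) (n : ℕ) :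
    alcove cs (cs.wordProd (spiralWord i j k n)) i = -((n + 1) / 2) ∧
    alcove cs (cs.wordProd (spiralWord i j k n)) j = 0 ∧
    alcove cs (cs.wordProd (spiralWord i j k n)) k = n / 2 := by
  induction n generalizing i j k with
  | zero => simp [spiralWord, alcove_one]
  | succ n ih =>
    obtain ⟨hj, hk, hi⟩ := ih h.rotate.rotate
    rw [spiralWord, cs.wordProd_cons, alcove_simple_mul, reflect_apply_self, reflect_apply_snd h,
      reflect_apply_trd h, hi, hj, hk]
    omega

theorem isSpiral_of_alcove_eq {w : W} (h : Distinct i j k) (n : ℕ)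
    (hi : alcove cs w i = -((n + 1) / 2)) (hj : alcove cs w j = 0)
    (hk : alcove cs w k = n / 2) : IsSpiral cs w := by
  obtain ⟨hi', hj', hk'⟩ := alcove_spiralWord (cs := cs) h n
  have heq : alcove cs (cs.wordProd (spiralWord i j k n)) = alcove cs w :=
    ext_of_distinct h (hi'.trans hi.symm) (hj'.trans hj.symm) (hk'.trans hk.symm)
  refine ⟨i, j, k, n, h.fst_ne_snd, h.snd_ne_trd, h.fst_ne_trd, ?_, alcove_injective cs heq⟩
  rw [CoxeterSystem.IsReduced, length_eq_norm, heq, length_spiralWord, norm_eq h]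
  omega

theorem isSpiral_of_alcove_apply_eq_zero {w : W} (hj : alcove cs w j = 0) : IsSpiral cs w := by
  obtain ⟨i, k, h⟩ := exists_distinct j
  have hsum := (alcove cs w).sum_eq_zero_or h
  wlog hk : 0 ≤ alcove cs w k generalizing i k with hwlog
  · exact hwlog k i h.rotate.swap (by omega) (by omega)
  exact isSpiral_of_alcove_eq h.swap (alcove cs w k - alcove cs w i).toNat (by omega) hj (by omega)

end

/-! ### Lower intervals are hexagons -/

namespace Alcove

section

variable {i j k : Fin 3} {w x : Alcove}

theorem le_iff_of_exists_reflect {P : Alcove → Prop} (hw : P w)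
    (hnorm : ∀ x, P x → x.norm ≤ w.norm)
    (down : ∀ x l m, x.norm < (reflect l m x).norm → P (reflect l m x) → P x)
    (up : ∀ x, P x → x ≠ w → ∃ l m, x.norm < (reflect l m x).norm ∧ P (reflect l m x)) :
    x ≤ w ↔ P x := by
  refine ⟨fun hx => ?_, fun hx => ?_⟩
  · induction hx using Alcove.le_induction with
    | refl => exact hw
    | step x l m hlt _ ih => exact down x l m hlt ih
  · induction hn : w.norm - x.norm using Nat.strong_induction_on generalizing x with
    | _ n ih =>
      by_cases hxw : x = w
      · exact hxw ▸ .refl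
      · obtain ⟨l, m, hlt, hP⟩ := up x hx hxw
        have := hnorm _ hP
        exact le_of_reflect_le hlt (ih _ (by omega) hP rfl)

/-- The lower interval of an alcove `w` with `w i, w j < 0`, that is, one lying beyond the vertex
`αᵢ = αⱼ = 0` of the fundamental alcove. The sides of the hexagon are perpendicular to the lines of
the arrangement, so they bound the differences of two of the coordinates. -/
def VertexHexagon (i j k : Fin 3) (w x : Alcove) : Prop :=
  (w i - w k ≤ x i - x k ∧ x i - x k ≤ w k - w j - 2) ∧
  (w j - w k ≤ x j - x k ∧ x j - x k ≤ w k - w i - 2) ∧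
  w j - w k + 1 ≤ x i - x j ∧ x i - x j ≤ w k - w i - 1

/-- The lower interval of an alcove `w` with `w i, w j > 0`, that is, one lying beyond the edge
`αₖ = 0` of the fundamental alcove; encoded like `VertexHexagon`. -/
def EdgeHexagon (i j k : Fin 3) (w x : Alcove) : Prop :=
  (w k - w j + 1 ≤ x i - x k ∧ x i - x k ≤ w i - w k) ∧
  (w k - w i + 1 ≤ x j - x k ∧ x j - x k ≤ w j - w k) ∧
  w k - w i + 2 ≤ x i - x j ∧ x i - x j ≤ w j - w k - 2

namespace VertexHexagon

theorem swap (hx : VertexHexagon i j k w x) : VertexHexagon j i k w x := by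
  unfold VertexHexagon at hx ⊢
  omega

theorem norm_le (h : Distinct i j k) (hx : VertexHexagon i j k w x) : x.norm ≤ w.norm := by
  have := x.sum_eq_zero_or h
  have := w.sum_eq_zero_or h
  unfold VertexHexagon at hx
  rw [norm_eq h, norm_eq h]
  omega

theorem of_reflect (h : Distinct i j k) {l : Fin 3} {m : ℤ}
    (hlt : x.norm < (reflect l m x).norm) (hx : VertexHexagon i j k w (reflect l m x)) :
    VertexHexagon i j k w x := by
  have hsum := x.sum_eq_zero_or h
  rw [norm_lt_norm_reflect_iff] at hlt
  obtain rfl | rfl | rfl := h.eq_or_eq_or_eq l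
  · simp only [VertexHexagon, reflect_apply_self, reflect_apply_snd h, reflect_apply_trd h] at hx ⊢
    omega
  · simp only [VertexHexagon, reflect_apply_self, reflect_apply_snd h.swap,
      reflect_apply_trd h.swap] at hx ⊢
    omega
  · simp only [VertexHexagon, reflect_apply_self, reflect_apply_snd h.rotate,
      reflect_apply_trd h.rotate] at hx ⊢
    omega

theorem exists_reflect_fst (h : Distinct i j k) (hj : w j < 0) (hx : VertexHexagon i j k w x)
    (hcase : 0 ≤ x i ∨ x j < 0 ∧ (x k - x i ≤ w k - w i - 3 ∨
      w k - w i - 3 < x k - x i ∧ w k - w j - 3 < x k - x j ∧ w i < x i)) :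
    ∃ m, x.norm < (reflect i m x).norm ∧ VertexHexagon i j k w (reflect i m x) := by
  -- Far from `w`, one of the lines `αᵢ = 0` and `αᵢ = 1` does it; near `w`, a wall of `w` does.
  have hw := w.sum_eq_zero_or h
  have hsum := x.sum_eq_zero_or h
  simp only [norm_lt_norm_reflect_iff, VertexHexagon, reflect_apply_self, reflect_apply_snd h,
    reflect_apply_trd h] at hx ⊢
  rcases lt_or_ge (x i) 0 with hxi | hxi
  · rcases hcase with hxi' | ⟨hxj, hfar | ⟨hnear, hnear', hlt⟩⟩
    · omega
    · refine ⟨1, ?_⟩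
      omega
    · refine ⟨w i + 1, ?_⟩
      omega
  · refine ⟨0, ?_⟩
    omega

theorem exists_reflect (h : Distinct i j k) (hi : w i < 0) (hj : w j < 0)
    (hx : VertexHexagon i j k w x) (hxw : x ≠ w) :
    ∃ l m, x.norm < (reflect l m x).norm ∧ VertexHexagon i j k w (reflect l m x) := by
  by_cases hfst : 0 ≤ x i ∨ x j < 0 ∧ (x k - x i ≤ w k - w i - 3 ∨
      w k - w i - 3 < x k - x i ∧ w k - w j - 3 < x k - x j ∧ w i < x i)
  · exact ⟨i, exists_reflect_fst h hj hx hfst⟩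
  by_cases hsnd : 0 ≤ x j ∨ x i < 0 ∧ (x k - x j ≤ w k - w j - 3 ∨
      w k - w j - 3 < x k - x j ∧ w k - w i - 3 < x k - x i ∧ w j < x j)
  · obtain ⟨m, hlt, hm⟩ := exists_reflect_fst h.swap hi hx.swap hsnd
    exact ⟨j, m, hlt, hm.swap⟩
  have hw := w.sum_eq_zero_or h
  have hsum := x.sum_eq_zero_or h
  have hxi : x i = w i := by unfold VertexHexagon at hx; omega
  have hxj : x j = w j := by unfold VertexHexagon at hx; omega
  have hxk : x k ≠ w k := fun hxk => hxw (ext_of_distinct h hxi hxj hxk)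
  refine ⟨k, w k, ?_⟩
  simp only [norm_lt_norm_reflect_iff, VertexHexagon, reflect_apply_self,
    reflect_apply_snd h.rotate, reflect_apply_trd h.rotate] at hx ⊢
  omega

end VertexHexagon

namespace EdgeHexagon

theorem swap (hx : EdgeHexagon i j k w x) : EdgeHexagon j i k w x := by
  unfold EdgeHexagon at hx ⊢
  omega

theorem norm_le (h : Distinct i j k) (hx : EdgeHexagon i j k w x) : x.norm ≤ w.norm := by
  have := x.sum_eq_zero_or h
  have := w.sum_eq_zero_or h
  unfold EdgeHexagon at hx
  rw [norm_eq h, norm_eq h]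
  omega

theorem of_reflect (h : Distinct i j k) {l : Fin 3} {m : ℤ}
    (hlt : x.norm < (reflect l m x).norm) (hx : EdgeHexagon i j k w (reflect l m x)) :
    EdgeHexagon i j k w x := by
  have hsum := x.sum_eq_zero_or h
  rw [norm_lt_norm_reflect_iff] at hlt
  obtain rfl | rfl | rfl := h.eq_or_eq_or_eq l
  · simp only [EdgeHexagon, reflect_apply_self, reflect_apply_snd h, reflect_apply_trd h] at hx ⊢
    omega
  · simp only [EdgeHexagon, reflect_apply_self, reflect_apply_snd h.swap,
      reflect_apply_trd h.swap] at hx ⊢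
    omega
  · simp only [EdgeHexagon, reflect_apply_self, reflect_apply_snd h.rotate,
      reflect_apply_trd h.rotate] at hx ⊢
    omega

theorem exists_reflect_fst (h : Distinct i j k) (hj : 0 < w j) (hx : EdgeHexagon i j k w x)
    (hcase : x i < 0 ∧ x k < 0 ∨ 0 ≤ x i ∧ (x i - x k ≤ w i - w k - 3 ∨
      w i - w k - 3 < x i - x k ∧ w j - w k - 3 < x j - x k ∧ x i < w i)) :
    ∃ m, x.norm < (reflect i m x).norm ∧ EdgeHexagon i j k w (reflect i m x) := by
  have hw := w.sum_eq_zero_or h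
  have hsum := x.sum_eq_zero_or h
  simp only [norm_lt_norm_reflect_iff, EdgeHexagon, reflect_apply_self, reflect_apply_snd h,
    reflect_apply_trd h] at hx ⊢
  rcases hcase with ⟨hxi, hxk⟩ | ⟨hxi, hfar | ⟨hnear, hnear', hlt⟩⟩
  · refine ⟨1, ?_⟩
    omega
  · refine ⟨0, ?_⟩
    omega
  · refine ⟨w i, ?_⟩
    omega

theorem exists_reflect (h : Distinct i j k) (hi : 0 < w i) (hj : 0 < w j)
    (hx : EdgeHexagon i j k w x) (hxw : x ≠ w) :
    ∃ l m, x.norm < (reflect l m x).norm ∧ EdgeHexagon i j k w (reflect l m x) := by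
  by_cases hfst : x i < 0 ∧ x k < 0 ∨ 0 ≤ x i ∧ (x i - x k ≤ w i - w k - 3 ∨
      w i - w k - 3 < x i - x k ∧ w j - w k - 3 < x j - x k ∧ x i < w i)
  · exact ⟨i, exists_reflect_fst h hj hx hfst⟩
  by_cases hsnd : x j < 0 ∧ x k < 0 ∨ 0 ≤ x j ∧ (x j - x k ≤ w j - w k - 3 ∨
      w j - w k - 3 < x j - x k ∧ w i - w k - 3 < x i - x k ∧ x j < w j)
  · obtain ⟨m, hlt, hm⟩ := exists_reflect_fst h.swap hi hx.swap hsnd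
    exact ⟨j, m, hlt, hm.swap⟩
  have hw := w.sum_eq_zero_or h
  have hsum := x.sum_eq_zero_or h
  refine ⟨k, if 0 ≤ x k then 0 else w k + 1, ?_⟩
  simp only [norm_lt_norm_reflect_iff, EdgeHexagon, reflect_apply_self,
    reflect_apply_snd h.rotate, reflect_apply_trd h.rotate] at hx ⊢
  split_ifs with hk
  · omega
  have hxi : x i = w i := by omega
  have hxj : x j = w j := by omega
  have hxk : x k ≠ w k := fun hxk => hxw (ext_of_distinct h hxi hxj hxk)
  omega

end EdgeHexagon

theorem le_iff_vertexHexagon (h : Distinct i j k) (hi : w i < 0) (hj : w j < 0) :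
    x ≤ w ↔ VertexHexagon i j k w x := by
  refine le_iff_of_exists_reflect ?_ (fun x => VertexHexagon.norm_le h)
    (fun x l m => VertexHexagon.of_reflect h)
    (fun x => VertexHexagon.exists_reflect h hi hj)
  have := w.sum_eq_zero_or h
  unfold VertexHexagon
  omega

theorem le_iff_edgeHexagon (h : Distinct i j k) (hi : 0 < w i) (hj : 0 < w j) :
    x ≤ w ↔ EdgeHexagon i j k w x := by
  refine le_iff_of_exists_reflect ?_ (fun x => EdgeHexagon.norm_le h)
    (fun x l m => EdgeHexagon.of_reflect h)
    (fun x => EdgeHexagon.exists_reflect h hi hj)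
  have := w.sum_eq_zero_or h
  unfold EdgeHexagon
  omega

end

end Alcove

/-! ### Counting reflections along chords -/

namespace Alcove

theorem card_Icc_ediv_three {u v : ℤ} (huv : v ≤ u + 2) (hr : (u + v) % 3 = 0 → (u - v) % 3 = 2) :
    ((Finset.Icc ((v + 2) / 3) (u / 3)).card : ℤ) = (u - v + 2) / 3 := by
  rw [Int.card_Icc]
  obtain ⟨a, r, hr0, hr3, rfl⟩ : ∃ a r : ℤ, 0 ≤ r ∧ r < 3 ∧ u = 3 * a + r :=
    ⟨u / 3, u % 3, by omega⟩
  obtain ⟨b, s, hs0, hs3, rfl⟩ : ∃ b s : ℤ, 0 ≤ s ∧ s < 3 ∧ v = 3 * b + s :=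
    ⟨v / 3, v % 3, by omega⟩
  interval_cases r <;> interval_cases s <;> omega

/-- The number of reflections in one direction that keep an alcove inside a hexagon of size `S`,
where `t` is the offset from the centre of the chord along which they move the alcove. The chord has
length about `S - |t|`, and the positions of one orientation on it are `3` apart. -/
def chord (S t : ℤ) : ℤ := (S - |t|) / 3

/-- The variant of `chord` for the directions in which an `EdgeHexagon` is centred at `t = 1/2`. The
maximum with `2` gives the two central chords `t = 0` and `t = 1` the length of their neighbours. -/
def shiftedChord (S t : ℤ) : ℤ := (S - max 2 (max t (1 - t))) / 3

theorem chord_neg (S t : ℤ) : chord S (-t) = chord S t := by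
  rw [chord, chord, abs_neg]

/-- A reflection preserves the chord in its own direction and turns the offsets `B`, `C` of the
other two into `3m - C`, `3m - B`. If it increases the norm, these are further from the centre. -/
theorem chord_add_chord_le {S B C m : ℤ} (hm : m ≤ 0 ∧ 3 * m ≤ B + C ∨ 0 < m ∧ B + C ≤ 3 * m) :
    chord S (3 * m - C) + chord S (3 * m - B) ≤ chord S B + chord S C := by
  simp only [chord, abs_eq_max_neg]
  omega

theorem shiftedChord_add_chord_le {S B C m : ℤ}
    (hm : m ≤ 0 ∧ 3 * m ≤ B + C ∨ 0 < m ∧ B + C < 3 * m) :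
    shiftedChord S (3 * m - 1 - C) + chord (S + 1) (3 * m - 1 - B) ≤
      shiftedChord S B + chord (S + 1) C := by
  simp only [chord, shiftedChord, abs_eq_max_neg]
  omega

theorem shiftedChord_add_chord_lt {S B C m : ℤ} (hS : S % 3 = 2)
    (hm : m ≤ 0 ∧ 3 * m ≤ B + C ∨ 0 < m ∧ B + C < 3 * m) (hB : B = 0 ∨ B = 1)
    (hB' : ¬(3 * m - 1 - C = 0 ∨ 3 * m - 1 - C = 1)) :
    shiftedChord S (3 * m - 1 - C) + chord (S + 1) (3 * m - 1 - B) <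
      shiftedChord S B + chord (S + 1) C := by
  simp only [chord, shiftedChord, abs_eq_max_neg]
  omega

theorem shiftedChord_add_shiftedChord_le {S A B m : ℤ}
    (hm : m ≤ 0 ∧ 3 * m + A + B ≤ 0 ∨ 0 < m ∧ 0 < 3 * m + A + B) :
    shiftedChord S (1 - 3 * m - B) + shiftedChord S (1 - 3 * m - A) ≤
      shiftedChord S A + shiftedChord S B := by
  simp only [shiftedChord]
  omega

theorem shiftedChord_add_shiftedChord_lt {S A B m : ℤ} (hS : S % 3 = 2)
    (hm : m ≤ 0 ∧ 3 * m + A + B ≤ 0 ∨ 0 < m ∧ 0 < 3 * m + A + B) (hA : A = 0 ∨ A = 1)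
    (hA' : ¬(1 - 3 * m - A = 0 ∨ 1 - 3 * m - A = 1))
    (hB' : ¬(1 - 3 * m - B = 0 ∨ 1 - 3 * m - B = 1)) :
    shiftedChord S (1 - 3 * m - B) + shiftedChord S (1 - 3 * m - A) <
      shiftedChord S A + shiftedChord S B := by
  simp only [shiftedChord]
  omega

section

variable {i j k l : Fin 3} {m : ℤ} {w x : Alcove}

namespace VertexHexagon

theorem exists_card_reflect_fst (h : Distinct i j k) (hx : VertexHexagon i j k w x) :
    ∃ s : Finset ℤ, (∀ m, VertexHexagon i j k w (reflect i m x) ↔ m ∈ s) ∧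
      s.card = chord (2 * w k - w i - w j) (x j - x k + w j - w i + 1) := by
  have hsum := x.sum_eq_zero_or h
  refine ⟨Finset.Icc ((x i + 1 - min (w k - w j - 1 + x k) (w k - w i + x j) + 2) / 3)
    ((x i + 1 + min (w k - w i - 1 - x k) (w k - w j - 2 - x j)) / 3), fun m => ?_, ?_⟩
  · simp only [VertexHexagon, reflect_apply_self, reflect_apply_snd h, reflect_apply_trd h,
      Finset.mem_Icc] at hx ⊢
    omega
  · unfold VertexHexagon at hx
    rw [card_Icc_ediv_three (by omega) (by omega), chord, abs_eq_max_neg]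
    congr 1
    omega

theorem exists_card_reflect_trd (h : Distinct i j k) (hx : VertexHexagon i j k w x) :
    ∃ s : Finset ℤ, (∀ m, VertexHexagon i j k w (reflect k m x) ↔ m ∈ s) ∧
      s.card = chord (2 * w k - w i - w j) (x i - x j + w j - w i) := by
  have hsum := x.sum_eq_zero_or h
  refine ⟨Finset.Icc ((x k + 1 - min (w k - w j - 2 + x j) (w k - w i - 2 + x i) + 2) / 3)
    ((x k + 1 + min (w k - w i - x j) (w k - w j - x i)) / 3), fun m => ?_, ?_⟩
  · simp only [VertexHexagon, reflect_apply_self, reflect_apply_snd h.rotate,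
      reflect_apply_trd h.rotate, Finset.mem_Icc] at hx ⊢
    omega
  · unfold VertexHexagon at hx
    rw [card_Icc_ediv_three (by omega) (by omega), chord, abs_eq_max_neg]
    congr 1
    omega

end VertexHexagon

namespace EdgeHexagon

theorem exists_card_reflect_fst (h : Distinct i j k) (hx : EdgeHexagon i j k w x) :
    ∃ s : Finset ℤ, (∀ m, EdgeHexagon i j k w (reflect i m x) ↔ m ∈ s) ∧
      s.card = shiftedChord (w i + w j - 2 * w k) (x j - x k + w j - w i) -
        if w i + w j + w k = -1 ∧ x j - x k + w j - w i = 1 + (x i + x j + x k) then 1 else 0 := by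
  have hw := w.sum_eq_zero_or h
  have hsum := x.sum_eq_zero_or h
  refine ⟨Finset.Icc ((x i + 1 - min (w i - w k - 2 + x k) (w j - w k - 1 + x j) + 2) / 3)
    ((x i + 1 + min (w j - w k - 2 - x k) (w i - w k - x j)) / 3), fun m => ?_, ?_⟩
  · simp only [EdgeHexagon, reflect_apply_self, reflect_apply_snd h, reflect_apply_trd h,
      Finset.mem_Icc] at hx ⊢
    omega
  · unfold EdgeHexagon at hx
    split_ifs with hdefect
    · rw [Int.card_Icc, shiftedChord]
      omega
    · rw [card_Icc_ediv_three (by omega) (by omega), shiftedChord, sub_zero]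
      omega

theorem exists_card_reflect_trd (h : Distinct i j k) (hx : EdgeHexagon i j k w x) :
    ∃ s : Finset ℤ, (∀ m, EdgeHexagon i j k w (reflect k m x) ↔ m ∈ s) ∧
      s.card = chord (w i + w j - 2 * w k + 1) (x i - x j + w j - w i) := by
  have hsum := x.sum_eq_zero_or h
  refine ⟨Finset.Icc ((x k + 1 - min (w i - w k + x j) (w j - w k + x i) + 2) / 3)
    ((x k + 1 + min (w j - w k - 1 - x j) (w i - w k - 1 - x i)) / 3), fun m => ?_, ?_⟩
  · simp only [EdgeHexagon, reflect_apply_self, reflect_apply_snd h.rotate,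
      reflect_apply_trd h.rotate, Finset.mem_Icc] at hx ⊢
    omega
  · unfold EdgeHexagon at hx
    rw [card_Icc_ediv_three (by omega) (by omega), chord, abs_eq_max_neg]
    congr 1
    omega

end EdgeHexagon

theorem numReflections_eq_of_neg (h : Distinct i j k) (hi : w i < 0) (hj : w j < 0) (hx : x ≤ w) :
    (numReflections w x : ℤ) =
      chord (2 * w k - w i - w j) (x j - x k + w j - w i + 1) +
      chord (2 * w k - w i - w j) (x i - x k + w i - w j + 1) +
      chord (2 * w k - w i - w j) (x i - x j + w j - w i) := by
  obtain ⟨s, hs, hscard⟩ := ((le_iff_vertexHexagon h hi hj).1 hx).exists_card_reflect_fst h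
  obtain ⟨t, ht, htcard⟩ :=
    ((le_iff_vertexHexagon h.swap hj hi).1 hx).exists_card_reflect_fst h.swap
  obtain ⟨u, hu, hucard⟩ := ((le_iff_vertexHexagon h hi hj).1 hx).exists_card_reflect_trd h
  rw [numReflections_eq_add_card h (fun m => (le_iff_vertexHexagon h hi hj).trans (hs m))
    (fun m => (le_iff_vertexHexagon h.swap hj hi).trans (ht m))
    (fun m => (le_iff_vertexHexagon h hi hj).trans (hu m))]
  push_cast
  rw [hscard, htcard, hucard, sub_right_comm _ (w j)]

theorem numReflections_reflect_fst_le_of_neg (h : Distinct i j k) (hi : w i < 0) (hj : w j < 0)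
    (hlt : x.norm < (reflect i m x).norm) (hle : reflect i m x ≤ w) :
    numReflections w (reflect i m x) ≤ numReflections w x := by
  zify
  rw [numReflections_eq_of_neg h hi hj hle,
    numReflections_eq_of_neg h hi hj (le_of_reflect_le hlt hle), reflect_apply_self,
    reflect_apply_snd h, reflect_apply_trd h]
  have hsum := x.sum_eq_zero_or h
  rw [norm_lt_norm_reflect_iff] at hlt
  have := chord_add_chord_le (S := 2 * w k - w i - w j) (m := m)
    (B := x i - x k + w i - w j + 1) (C := x i - x j + w j - w i) (by omega)
  ring_nf at this ⊢
  linarith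

theorem numReflections_reflect_trd_le_of_neg (h : Distinct i j k) (hi : w i < 0) (hj : w j < 0)
    (hlt : x.norm < (reflect k m x).norm) (hle : reflect k m x ≤ w) :
    numReflections w (reflect k m x) ≤ numReflections w x := by
  zify
  rw [numReflections_eq_of_neg h hi hj hle,
    numReflections_eq_of_neg h hi hj (le_of_reflect_le hlt hle), reflect_apply_self,
    reflect_apply_snd h.rotate, reflect_apply_trd h.rotate]
  have hsum := x.sum_eq_zero_or h
  rw [norm_lt_norm_reflect_iff] at hlt
  have := chord_add_chord_le (S := 2 * w k - w i - w j) (m := 1 - m)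
    (B := x i - x k + w i - w j + 1) (C := x j - x k + w j - w i + 1) (by omega)
  ring_nf at this ⊢
  linarith

theorem numReflections_reflect_le_of_neg (h : Distinct i j k) (hi : w i < 0) (hj : w j < 0)
    (hlt : x.norm < (reflect l m x).norm) (hle : reflect l m x ≤ w) :
    numReflections w (reflect l m x) ≤ numReflections w x := by
  obtain rfl | rfl | rfl := h.eq_or_eq_or_eq l
  · exact numReflections_reflect_fst_le_of_neg h hi hj hlt hle
  · exact numReflections_reflect_fst_le_of_neg h.swap hj hi hlt hle
  · exact numReflections_reflect_trd_le_of_neg h hi hj hlt hle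

/-- The number of reflections taking `x` below `w` when `w i, w j > 0`, except that on the alcoves
with `HasDefect` it is one too large. In contrast to that number it is antitone in `x`. -/
def edgePotential (i j k : Fin 3) (w x : Alcove) : ℤ :=
  shiftedChord (w i + w j - 2 * w k) (x j - x k + w j - w i) +
  shiftedChord (w i + w j - 2 * w k) (x i - x k + w i - w j) +
  chord (w i + w j - 2 * w k + 1) (x i - x j + w j - w i)

/-- The alcove `x` lies on one of the chords `t = 0`, `t = 1` in a direction counted by
`shiftedChord`. -/
def IsCentral (i j k : Fin 3) (w x : Alcove) : Prop :=
  (x j - x k + w j - w i = 0 ∨ x j - x k + w j - w i = 1) ∨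
    x i - x k + w i - w j = 0 ∨ x i - x k + w i - w j = 1

/-- The alcoves `x` for which a central chord admits one reflection fewer than `shiftedChord`
predicts. -/
def HasDefect (i j k : Fin 3) (w x : Alcove) : Prop :=
  w i + w j + w k = -1 ∧ (x j - x k + w j - w i = 1 + (x i + x j + x k) ∨
    x i - x k + w i - w j = 1 + (x i + x j + x k))

open Classical in
theorem numReflections_eq_of_pos (h : Distinct i j k) (hi : 0 < w i) (hj : 0 < w j) (hx : x ≤ w) :
    (numReflections w x : ℤ) =
      edgePotential i j k w x - if HasDefect i j k w x then 1 else 0 := by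
  obtain ⟨s, hs, hscard⟩ := ((le_iff_edgeHexagon h hi hj).1 hx).exists_card_reflect_fst h
  obtain ⟨t, ht, htcard⟩ :=
    ((le_iff_edgeHexagon h.swap hj hi).1 hx).exists_card_reflect_fst h.swap
  obtain ⟨u, hu, hucard⟩ := ((le_iff_edgeHexagon h hi hj).1 hx).exists_card_reflect_trd h
  rw [numReflections_eq_add_card h (fun m => (le_iff_edgeHexagon h hi hj).trans (hs m))
    (fun m => (le_iff_edgeHexagon h.swap hj hi).trans (ht m))
    (fun m => (le_iff_edgeHexagon h hi hj).trans (hu m))]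
  push_cast
  rw [hscard, htcard, hucard, edgePotential, add_comm (w j), add_comm (x j) (x i)]
  have hsum := x.sum_eq_zero_or h
  simp only [HasDefect]
  split_ifs <;> omega

theorem edgePotential_swap (i j k : Fin 3) (w x : Alcove) :
    edgePotential j i k w x = edgePotential i j k w x := by
  rw [edgePotential, edgePotential, ← chord_neg, add_comm (w j), add_comm (shiftedChord _ _)]
  congr 2
  ring

theorem isCentral_swap : IsCentral j i k w x ↔ IsCentral i j k w x :=
  or_comm

theorem HasDefect.isCentral (h : Distinct i j k) (hx : HasDefect i j k w x) :
    IsCentral i j k w x := by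
  have hsum := x.sum_eq_zero_or h
  unfold HasDefect at hx
  unfold IsCentral
  omega

theorem two_dvd_edgePotential_sub_norm (h : Distinct i j k) (hi : 0 < w i) (hj : 0 < w j)
    (hw : w i + w j + w k = -1) (hx : IsCentral i j k w x) (hdefect : ¬HasDefect i j k w x) :
    2 ∣ edgePotential i j k w x - w.norm := by
  have hsum := x.sum_eq_zero_or h
  rw [norm_eq h]
  unfold IsCentral at hx
  unfold HasDefect at hdefect
  simp only [edgePotential, chord, shiftedChord, abs_eq_max_neg]
  omega

theorem edgePotential_reflect_fst_le (h : Distinct i j k) (w : Alcove)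
    (hlt : x.norm < (reflect i m x).norm) :
    edgePotential i j k w (reflect i m x) ≤ edgePotential i j k w x := by
  have hsum := x.sum_eq_zero_or h
  rw [norm_lt_norm_reflect_iff] at hlt
  have := shiftedChord_add_chord_le (S := w i + w j - 2 * w k) (m := m)
    (B := x i - x k + w i - w j) (C := x i - x j + w j - w i) (by omega)
  rw [edgePotential, edgePotential, reflect_apply_self, reflect_apply_snd h, reflect_apply_trd h]
  ring_nf at this ⊢
  linarith

theorem edgePotential_reflect_trd_le (h : Distinct i j k) (w : Alcove)
    (hlt : x.norm < (reflect k m x).norm) :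
    edgePotential i j k w (reflect k m x) ≤ edgePotential i j k w x := by
  have hsum := x.sum_eq_zero_or h
  rw [norm_lt_norm_reflect_iff] at hlt
  have := shiftedChord_add_shiftedChord_le (S := w i + w j - 2 * w k) (m := m)
    (A := x j - x k + w j - w i) (B := x i - x k + w i - w j) (by omega)
  rw [edgePotential, edgePotential, reflect_apply_self, reflect_apply_snd h.rotate,
    reflect_apply_trd h.rotate]
  ring_nf at this ⊢
  linarith

theorem edgePotential_reflect_le (h : Distinct i j k) (w : Alcove)
    (hlt : x.norm < (reflect l m x).norm) :
    edgePotential i j k w (reflect l m x) ≤ edgePotential i j k w x := by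
  obtain rfl | rfl | rfl := h.eq_or_eq_or_eq l
  · exact edgePotential_reflect_fst_le h w hlt
  · rw [← edgePotential_swap, ← edgePotential_swap i]
    exact edgePotential_reflect_fst_le h.swap w hlt
  · exact edgePotential_reflect_trd_le h w hlt

theorem edgePotential_reflect_fst_lt (h : Distinct i j k) (hw : w i + w j + w k = -1)
    (hlt : x.norm < (reflect i m x).norm) (hx : IsCentral i j k w x)
    (hy : ¬IsCentral i j k w (reflect i m x)) :
    edgePotential i j k w (reflect i m x) < edgePotential i j k w x := by
  have hsum := x.sum_eq_zero_or h
  rw [norm_lt_norm_reflect_iff] at hlt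
  simp only [IsCentral, reflect_apply_self, reflect_apply_snd h, reflect_apply_trd h] at hx hy
  have := shiftedChord_add_chord_lt (S := w i + w j - 2 * w k) (m := m)
    (B := x i - x k + w i - w j) (C := x i - x j + w j - w i) (by omega) (by omega) (by omega)
    (by omega)
  rw [edgePotential, edgePotential, reflect_apply_self, reflect_apply_snd h, reflect_apply_trd h]
  ring_nf at this ⊢
  linarith

theorem edgePotential_reflect_trd_lt (h : Distinct i j k) (hw : w i + w j + w k = -1)
    (hlt : x.norm < (reflect k m x).norm) (hx : IsCentral i j k w x)
    (hy : ¬IsCentral i j k w (reflect k m x)) :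
    edgePotential i j k w (reflect k m x) < edgePotential i j k w x := by
  wlog hj : x j - x k + w j - w i = 0 ∨ x j - x k + w j - w i = 1 generalizing i j
  · have hi := hx.resolve_left hj
    have := this h.swap (by omega) (isCentral_swap.2 hx) (mt isCentral_swap.1 hy) hi
    rwa [edgePotential_swap i j, edgePotential_swap i j] at this
  have hsum := x.sum_eq_zero_or h
  rw [norm_lt_norm_reflect_iff] at hlt
  simp only [IsCentral, reflect_apply_self, reflect_apply_snd h.rotate,
    reflect_apply_trd h.rotate] at hy
  have := shiftedChord_add_shiftedChord_lt (S := w i + w j - 2 * w k) (m := m)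
    (A := x j - x k + w j - w i) (B := x i - x k + w i - w j) (by omega) (by omega) hj
    (by omega) (by omega)
  rw [edgePotential, edgePotential, reflect_apply_self, reflect_apply_snd h.rotate,
    reflect_apply_trd h.rotate]
  ring_nf at this ⊢
  linarith

theorem edgePotential_reflect_lt (h : Distinct i j k) (hw : w i + w j + w k = -1)
    (hlt : x.norm < (reflect l m x).norm) (hx : IsCentral i j k w x)
    (hy : ¬IsCentral i j k w (reflect l m x)) :
    edgePotential i j k w (reflect l m x) < edgePotential i j k w x := by
  obtain rfl | rfl | rfl := h.eq_or_eq_or_eq l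
  · exact edgePotential_reflect_fst_lt h hw hlt hx hy
  · rw [← edgePotential_swap, ← edgePotential_swap i]
    exact edgePotential_reflect_fst_lt h.swap (by omega) hlt (isCentral_swap.2 hx)
      (mt isCentral_swap.1 hy)
  · exact edgePotential_reflect_trd_lt h hw hlt hx hy

theorem norm_lt_numReflections_of_reflect_of_pos (h : Distinct i j k) (hi : 0 < w i) (hj : 0 < w j)
    (hlt : x.norm < (reflect l m x).norm) (hle : reflect l m x ≤ w)
    (hy : w.norm < numReflections w (reflect l m x)) : w.norm < numReflections w x := by
  have hx := numReflections_eq_of_pos h hi hj (le_of_reflect_le hlt hle)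
  have hy' := numReflections_eq_of_pos h hi hj hle
  have hpot := edgePotential_reflect_le h w hlt
  -- Only a defect of `x` that the reflected alcove does not share could hurt. Then either the
  -- potential drops strictly, or its positive excess over the norm is even, hence at least `2`.
  by_cases hdx : HasDefect i j k w x
  · rw [if_pos hdx] at hx
    by_cases hdy : HasDefect i j k w (reflect l m x)
    · rw [if_pos hdy] at hy'
      omega
    rw [if_neg hdy] at hy'
    by_cases hcy : IsCentral i j k w (reflect l m x)
    · have := two_dvd_edgePotential_sub_norm h hi hj hdx.1 hcy hdy
      omega
    · have := edgePotential_reflect_lt h hdx.1 hlt (hdx.isCentral h) hcy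
      omega
  · rw [if_neg hdx] at hx
    split_ifs at hy' <;> omega

theorem exists_distinct_neg_or_pos (hw : ∀ l, w l ≠ 0) :
    ∃ i j k, Distinct i j k ∧ (w i < 0 ∧ w j < 0 ∨ 0 < w i ∧ 0 < w j) := by
  obtain ⟨j, k, h⟩ := exists_distinct 0
  have hi := hw 0
  have hj := hw j
  have hk := hw k
  by_cases hij : w 0 < 0 ↔ w j < 0
  · exact ⟨0, j, k, h, by omega⟩
  by_cases hki : w k < 0 ↔ w 0 < 0
  · exact ⟨k, 0, j, h.rotate, by omega⟩
  · exact ⟨j, k, 0, h.rotate.rotate, by omega⟩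

theorem norm_lt_numReflections_of_le {y : Alcove} (hw : ∀ l, w l ≠ 0) (hyx : y ≤ x) (hxw : x ≤ w)
    (hx : w.norm < numReflections w x) : w.norm < numReflections w y := by
  obtain ⟨i, j, k, h, hij⟩ := exists_distinct_neg_or_pos hw
  suffices y ≤ w ∧ w.norm < numReflections w y from this.2
  induction hyx using Alcove.le_induction with
  | refl => exact ⟨hxw, hx⟩
  | step y l m hlt _ ih =>
    obtain ⟨hle, hnorm⟩ := ih
    refine ⟨le_of_reflect_le hlt hle, ?_⟩
    rcases hij with ⟨hi, hj⟩ | ⟨hi, hj⟩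
    · exact hnorm.trans_le (numReflections_reflect_le_of_neg h hi hj hlt hle)
    · exact norm_lt_numReflections_of_reflect_of_pos h hi hj hlt hle hnorm

end

end Alcove

end AffineA2

theorem theoremt {W : Type*} [Group W] (cs : CoxeterSystem AffineA2.matrix W) (w x y : W)
    (hw : ¬ AffineA2.IsSpiral cs w) (hyx : cs.BruhatLE y x) (hxw : cs.BruhatLE x w)
    (hq : 0 < cs.q w x) : 0 < cs.q w y := by
  have hnonzero (l : Fin 3) : AffineA2.alcove cs w l ≠ 0 :=
    mt AffineA2.isSpiral_of_alcove_apply_eq_zero hw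
  rw [AffineA2.bruhatLE_iff] at hyx hxw
  rw [AffineA2.q_eq, sub_pos, Nat.cast_lt] at hq ⊢
  exact AffineA2.Alcove.norm_lt_numReflections_of_le hnonzero hyx hxw hq
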